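/- For $n\ge 0$, a code of length $n$ is a nonempty set $\mathcal C\subseteq\mathbb F_2^n$ together with a (possibly randomized) decoder $\phi:\mathbb F_2^n\to\mathcal C$; its rate is $\frac1n\log_2|\mathcal C|$. A memoryless adversary strategy of length $n$ is an $n$-tuple of jointly distributed random functions $f^i:\mathbb F_2\to\mathbb F_2$ (possibly dependent on each other, independent of the transmitted codeword and of the decoder's randomness). If $\mathbf x\in\mathcal C$ is sent, the error vector is $f(\mathbf x)=(f^1(x_1),\dots,f^n(x_n))$ and $\mathbf x+f(\mathbf x)$ is received; the average error probability is $P(\mathcal C,f)=\frac1{|\mathcal C|}\sum_{\mathbf x\in\mathcal C}\Pr(\phi(\mathbf x+f(\mathbf x))\ne\mathbf x)$. Let $(\mathcal C_n)_n$ be a family of codes, $\mathcal C_n$ of length $n$. A family $(f_n)_n$ of strategies, which may depend on the codes, is strongly-$p$-limited for $(\mathcal C_n)$ if for every $\epsilon>0$, with $\mathbf x$ uniform on $\mathcal C_n$, $\Pr(\mathrm{wt}(f_n(\mathbf x))/n<p+\epsilon)\to1$ as $n\to\infty$, where $\mathrm{wt}$ is the Hamming weight. For $\epsilon>0$ call $(\mathcal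 C_n)$ $\epsilon$-good if for every strongly-$p$-limited $(f_n)$ one has $P(\mathcal C_n,f_n)\le\epsilon$ for all sufficiently large $n$. The capacity of the strongly-$p$-limited memoryless adversary is $$C_s(p)=\inf_{\epsilon>0}\ \sup_{(\mathcal C_n)\ \epsilon\text{-good}}\ \limsup_{n\to\infty}\frac{\log_2|\mathcal C_n|}{n}.$$ Let $h_B(x)=-x\log_2x-(1-x)\log_2(1-x)$. **Theorem.** If $0\le p\le\frac14$, then $C_s(p)\le 1-h_B(p)$. If $\frac14<p\le\frac12$, then $C_s(p)\le h_B(1-3p+4p^2)-h_B(p)$. Moreover, for $\frac14<p<\frac12$ this last bound is strictly below $1-h_B(p)$ (the well-known value of the capacity of the binary symmetric channel with crossover probability $p$): $h_B(1-3p+4p^2)-h_B(p)<1-h_B(p)$. -/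

import Mathlib

open Filter

noncomputable section

/-- The Hamming space `𝔽₂ⁿ`. -/
abbrev Word (n : ℕ) : Type := Fin n → ZMod 2

/-- The binary entropy function, in bits. -/
def hB (x : ℝ) : ℝ := Real.binEntropy x / Real.log 2

/-- A (nonempty) binary code of length `n`, together with its associated, possibly randomized,
decoder `φ : 𝔽₂ⁿ → 𝒞`. -/
structure Code (n : ℕ) where
  words : Finset (Word n)
  nonempty : words.Nonempty
  decoder : Word n → PMF words

/-- A memoryless adversary strategy: `n` random functions `fⁱ : 𝔽₂ → 𝔽₂`, given by their joint
law (the functions may share randomness; they are independent of the transmitted codeword and of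
the decoder). -/
abbrev Strategy (n : ℕ) : Type := PMF (Fin n → ZMod 2 → ZMod 2)

/-- The error vector `e`, with `eᵢ = fⁱ(xᵢ)`. -/
def errorVector {n : ℕ} (f : Fin n → ZMod 2 → ZMod 2) (x : Word n) : Word n :=
  fun i => f i (x i)

/-- `Pr(wt(e)/n < t)`, for a uniformly random codeword of `C` and the strategy `ν`. -/
def probWeightLT {n : ℕ} (C : Code n) (ν : Strategy n) (t : ℝ) : ℝ :=
  (1 / (C.words.card : ℝ)) * ∑ x ∈ C.words, ∑ f : Fin n → ZMod 2 → ZMod 2,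
    if (hammingNorm (errorVector f x) : ℝ) / n < t then (ν f).toReal else 0

/-- The average probability of error
`(1/|𝒞|) ∑_{x ∈ 𝒞} Pr(φ(x + f(x)) ≠ x)` under the strategy `ν`. -/
def avgError {n : ℕ} (C : Code n) (ν : Strategy n) : ℝ :=
  (1 / (C.words.card : ℝ)) * ∑ x : C.words, ∑ f : Fin n → ZMod 2 → ZMod 2,
    (ν f).toReal * (1 - (C.decoder (x.1 + errorVector f x.1) x).toReal)

/-- The strategies `ν` (one for each length) form a strongly-`p`-limited adversary for the code
family `C`: for all `ε > 0`, `Pr(wt(e)/n < p + ε) = 1 - o(1)`. -/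
def StronglyLimited (C : ∀ n, Code n) (p : ℝ) (ν : ∀ n, Strategy n) : Prop :=
  ∀ ε : ℝ, 0 < ε → Tendsto (fun n => probWeightLT (C n) (ν n) (p + ε)) atTop (nhds 1)

/-- The code family `C` has average error probability at most `ε`, for large lengths, against
every strongly-`p`-limited adversary. -/
def IsGood (p ε : ℝ) (C : ∀ n, Code n) : Prop :=
  ∀ ν : ∀ n, Strategy n, StronglyLimited C p ν → ∀ᶠ n in atTop, avgError (C n) (ν n) ≤ ε

/-- The rate `log₂ |𝒞| / n`. -/
def rate {n : ℕ} (C : Code n) : ℝ := Real.logb 2 (C.words.card : ℝ) / n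

/-- The capacity `C_s(p)` of the strongly-`p`-limited memoryless adversary: the infimum over
`ε > 0` of the largest asymptotic rate `limsup_n log₂ |𝒞ₙ| / n` of a code family whose error
probability is at most `ε`. -/
def strongCapacity (p : ℝ) : EReal :=
  ⨅ (ε : ℝ) (_ : 0 < ε), ⨆ (C : ∀ n, Code n) (_ : IsGood p ε C),
    limsup (fun n => ((rate (C n) : ℝ) : EReal)) atTop

end

/-! ### Product Bernoulli weights on the Hamming space -/

/-! Two attacks suffice. The first is Bernoulli noise of rate `p`. Typical noise vectors have
probability about `2^(-n h(p))`, and for each received word the decoding probabilities sum to one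
over the code. So if the received words mostly lie in a set `T`, the expected number of correctly
decoded words is at most about `|T| 2^(-n h(p))` (`le_avgError_bscStrategy`). Taking `T` to be the
whole space gives `1 - h(p)`.

For `p > 1/4`, call a codeword central if at most a fraction `δ` of the code lies farther than `2pn`
from it.

If half of the code is central, the second attack overwrites a random half of the coordinates by
those of a random central word `x'`. The cost is about half the distance, so usually at most `pn`.
The received word has the same law when `x` and `x'` are exchanged, so the decoder fails on a
constant fraction (`le_avgError_symStrategy`).

Otherwise a bounded number of words `d` suffice for a quarter of the code to be far from at least
one of them (`exists_card_le_far_cover`). Noise carries a word at distance at least `2pn` from `d`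
to distance about `(p + 2p(1 - 2p))n = (3p - 4p²)n` or more. This exceeds `n/2`, so the received
words lie in a few complements of balls, of total size about `2^(n h(3p - 4p²))`. The first attack
with this smaller `T` gives the bound, since `h(3p - 4p²) = h(1 - 3p + 4p²)`. -/

theorem zmod_two_cases : ∀ a : ZMod 2, a = 0 ∨ a = 1 := by decide

theorem sum_zmod_two {M : Type*} [AddCommMonoid M] (f : ZMod 2 → M) :
    ∑ a, f a = f 0 + f 1 := Fin.sum_univ_two f

/-- The Bernoulli weight with parameter `p` on `𝔽₂`. -/
noncomputable def bernWeight (p : ℝ) (a : ZMod 2) : ℝ := if a = 0 then 1 - p else p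

/-- The probability of the noise vector `e` of a binary symmetric channel with crossover
probability `p`. -/
noncomputable def noiseWeight (p : ℝ) {n : ℕ} (e : Word n) : ℝ := ∏ i, bernWeight p (e i)

theorem bernWeight_nonneg {p : ℝ} (h0 : 0 ≤ p) (h1 : p ≤ 1) (a : ZMod 2) : 0 ≤ bernWeight p a := by
  unfold bernWeight; split_ifs <;> linarith

theorem noiseWeight_nonneg {p : ℝ} (h0 : 0 ≤ p) (h1 : p ≤ 1) {n : ℕ} (e : Word n) :
    0 ≤ noiseWeight p e :=
  Finset.prod_nonneg fun i _ => bernWeight_nonneg h0 h1 (e i)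

theorem sum_bernWeight (p : ℝ) : ∑ a, bernWeight p a = 1 := by
  rw [sum_zmod_two]; simp [bernWeight]

theorem sum_noiseWeight_mul_prod (p : ℝ) {n : ℕ} (u : Fin n → ZMod 2 → ℝ) :
    ∑ e : Word n, noiseWeight p e * ∏ i, u i (e i) = ∏ i, ∑ a, bernWeight p a * u i a := by
  rw [Finset.prod_univ_sum, Fintype.piFinset_univ]
  exact Finset.sum_congr rfl fun e _ => by rw [noiseWeight, Finset.prod_mul_distrib]

theorem sum_noiseWeight (p : ℝ) (n : ℕ) : ∑ e : Word n, noiseWeight p e = 1 := by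
  simpa [sum_bernWeight] using sum_noiseWeight_mul_prod p (n := n) fun _ _ => 1

/-- Distinct centred coordinates are uncorrelated under the product weight. -/
theorem sum_noiseWeight_mul_mul_eq_zero (p : ℝ) {n : ℕ} (g : Fin n → ZMod 2 → ℝ)
    (hg : ∀ i, ∑ a, bernWeight p a * g i a = 0) {i j : Fin n} (hij : i ≠ j) :
    ∑ e : Word n, noiseWeight p e * (g i (e i) * g j (e j)) = 0 := by
  -- The indicators leave a factor different from one only at `i` and `j`; since `i ≠ j`, the factor
  -- at `i` is the vanishing mean of `g i`.
  have key := sum_noiseWeight_mul_prod p (n := n)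
    fun k a => (if k = i then g i a else 1) * (if k = j then g j a else 1)
  rw [Finset.prod_eq_zero (Finset.mem_univ i) (by simpa [hij] using hg i)] at key
  rw [← key]
  refine Finset.sum_congr rfl fun e _ => ?_
  rw [Finset.prod_mul_distrib]
  simp

/-- Chebyshev's inequality for a sum of functions of the coordinates with ranges of length at
most one. -/
theorem chebyshev_noiseWeight {p : ℝ} (h0 : 0 ≤ p) (h1 : p ≤ 1) {n : ℕ}
    (g : Fin n → ZMod 2 → ℝ) (hg : ∀ i, ∑ a, bernWeight p a * g i a = 0)
    (hb : ∀ i a, |g i a| ≤ 1) {γ : ℝ} (hγ : 0 < γ) (hn : 0 < n)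
    (P : Word n → Prop) [DecidablePred P] (hP : ∀ e, P e → γ * n ≤ |∑ i, g i (e i)|) :
    ∑ e : Word n, (if P e then noiseWeight p e else 0) ≤ 1 / (γ ^ 2 * n) := by
  have hn' : (0 : ℝ) < n := by exact_mod_cast hn
  have hvar : ∑ e : Word n, noiseWeight p e * (∑ i, g i (e i)) ^ 2 ≤ n := by
    have : ∀ e : Word n, noiseWeight p e * (∑ i, g i (e i)) ^ 2
        = ∑ i, ∑ j, noiseWeight p e * (g i (e i) * g j (e j)) := by
      intro e
      rw [sq, Finset.sum_mul_sum, Finset.mul_sum]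
      exact Finset.sum_congr rfl fun i _ => by rw [Finset.mul_sum]
    simp_rw [this]
    rw [Finset.sum_comm]
    calc ∑ i : Fin n, ∑ e : Word n, ∑ j, noiseWeight p e * (g i (e i) * g j (e j))
        ≤ ∑ i : Fin n, (1 : ℝ) := by
          refine Finset.sum_le_sum fun i _ => ?_
          rw [Finset.sum_comm, Finset.sum_eq_single i
            (fun j _ hj => sum_noiseWeight_mul_mul_eq_zero p g hg hj.symm) (by simp),
            ← sum_noiseWeight p n]
          refine Finset.sum_le_sum fun e _ => ?_
          have := abs_le.1 (hb i (e i))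
          exact mul_le_of_le_one_right (noiseWeight_nonneg h0 h1 e) (by nlinarith)
      _ = n := by simp
  have hmarkov : (γ * n) ^ 2 * ∑ e : Word n, (if P e then noiseWeight p e else 0)
      ≤ ∑ e : Word n, noiseWeight p e * (∑ i, g i (e i)) ^ 2 := by
    rw [Finset.mul_sum]
    refine Finset.sum_le_sum fun e _ => ?_
    have hw := noiseWeight_nonneg h0 h1 e
    split_ifs with h
    · rw [mul_comm, ← sq_abs (∑ i, g i (e i))]
      exact mul_le_mul_of_nonneg_left (pow_le_pow_left₀ (by positivity) (hP e h) 2) hw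
    · rw [mul_zero]; positivity
  rw [le_div_iff₀ (by positivity)]
  have := hmarkov.trans hvar
  refine le_of_mul_le_mul_right ?_ hn'
  calc _ = (γ * n) ^ 2 * ∑ e : Word n, (if P e then noiseWeight p e else 0) := by ring
    _ ≤ 1 * n := by linarith

theorem hammingDist_eq_sum {n : ℕ} (x y : Word n) :
    (hammingDist x y : ℝ) = ∑ i, if x i ≠ y i then (1 : ℝ) else 0 := by
  rw [hammingDist, Finset.card_filter]; push_cast; rfl

theorem hammingNorm_eq_sum {n : ℕ} (x : Word n) :
    (hammingNorm x : ℝ) = ∑ i, if x i ≠ 0 then (1 : ℝ) else 0 := by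
  rw [hammingNorm, Finset.card_filter]; push_cast; rfl

/-- Law of large numbers for the weight of the noise. -/
theorem noiseWeight_hammingNorm_deviation {p : ℝ} (h0 : 0 ≤ p) (h1 : p ≤ 1) {n : ℕ} (hn : 0 < n)
    {γ : ℝ} (hγ : 0 < γ) (P : Word n → Prop) [DecidablePred P]
    (hP : ∀ e, P e → γ * n ≤ |(hammingNorm e : ℝ) - p * n|) :
    ∑ e : Word n, (if P e then noiseWeight p e else 0) ≤ 1 / (γ ^ 2 * n) := by
  refine chebyshev_noiseWeight h0 h1 (fun _ a => (if a ≠ 0 then 1 else 0) - p) ?_ ?_ hγ hn P ?_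
  · intro i; rw [sum_zmod_two]; simp [bernWeight]; ring
  · intro i a; rw [abs_le]; split_ifs <;> constructor <;> linarith
  · intro e he
    have := hP e he
    rw [hammingNorm_eq_sum] at this
    simpa [Finset.sum_sub_distrib, mul_comm p] using this

/-- A noisy version of `x` is unlikely to be much closer to `d` than expected. -/
theorem noiseWeight_hammingDist_deviation {p : ℝ} (h0 : 0 ≤ p) (h1 : p ≤ 1 / 2) {n : ℕ}
    (hn : 0 < n) {γ s r : ℝ} (hγ : 0 < γ) (x d : Word n) (hd : s * n ≤ hammingDist x d)
    (hr : r ≤ p + s * (1 - 2 * p) - γ) :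
    ∑ e : Word n, (if ¬ r * n ≤ hammingDist (x + e) d then noiseWeight p e else 0)
      ≤ 1 / (γ ^ 2 * n) := by
  have hn' : (0 : ℝ) < n := by exact_mod_cast hn
  refine chebyshev_noiseWeight h0 (by linarith)
    -- The subtracted term is the mean: the noisy coordinate differs from `d i` with probability `1
    -- - p` if `x i` already did, and `p` otherwise.
    (fun i a => (if x i + a ≠ d i then 1 else 0) - (if x i ≠ d i then 1 - p else p))
    ?_ ?_ hγ hn _ ?_
  · intro i
    rw [sum_zmod_two]
    generalize x i = a
    generalize d i = b
    have h11 : (1 : ZMod 2) + 1 = 0 := by decide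
    rcases zmod_two_cases a with rfl | rfl <;> rcases zmod_two_cases b with rfl | rfl <;>
      simp [bernWeight, h11] <;> ring
  · intro i a; rw [abs_le]; split_ifs <;> constructor <;> linarith
  · intro e he
    have hm : ∑ i, (if x i ≠ d i then 1 - p else p) = p * n + (1 - 2 * p) * hammingDist x d := by
      rw [hammingDist_eq_sum, Finset.mul_sum]
      have : (p * n : ℝ) = ∑ i : Fin n, p := by simp [mul_comm]
      rw [this, ← Finset.sum_add_distrib]
      exact Finset.sum_congr rfl fun i _ => by split_ifs <;> ring
    rw [Finset.sum_sub_distrib, hm]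
    have := hammingDist_eq_sum (x + e) d
    simp only [Pi.add_apply] at this
    rw [← this, abs_sub_comm]
    refine le_trans ?_ (le_abs_self _)
    push Not at he
    nlinarith [mul_le_mul_of_nonneg_left hd (by linarith : (0 : ℝ) ≤ 1 - 2 * p),
      mul_le_mul_of_nonneg_right hr hn'.le]

theorem noiseWeight_eq_exp {p : ℝ} (h0 : 0 < p) (h1 : p < 1) {n : ℕ} (e : Word n) :
    noiseWeight p e = Real.exp (n * Real.log (1 - p)
      + hammingNorm e * (Real.log p - Real.log (1 - p))) := by
  have : ∀ a : ZMod 2, bernWeight p a = Real.exp (Real.log (1 - p)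
      + (if a ≠ 0 then (1 : ℝ) else 0) * (Real.log p - Real.log (1 - p))) := by
    intro a
    unfold bernWeight
    rcases eq_or_ne a 0 with h | h
    · simp [h, Real.exp_log (by linarith : 0 < 1 - p)]
    · simp [h, Real.exp_log h0]
  simp_rw [noiseWeight, this]
  rw [← Real.exp_sum, Finset.sum_add_distrib, ← Finset.sum_mul, hammingNorm_eq_sum]
  simp

theorem binEntropy_eq_neg (p : ℝ) :
    Real.binEntropy p = -(p * Real.log p) - (1 - p) * Real.log (1 - p) := by
  simp [Real.binEntropy, Real.log_inv]; ring

/-- Typical noise vectors have small probability. -/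
theorem noiseWeight_le_exp {p : ℝ} (h0 : 0 < p) (h1 : p ≤ 1 / 2) {n : ℕ} (e : Word n) {γ : ℝ}
    (he : (p - γ) * n ≤ hammingNorm e) :
    noiseWeight p e
      ≤ Real.exp (-(n * (Real.binEntropy p - γ * (Real.log (1 - p) - Real.log p)))) := by
  rw [noiseWeight_eq_exp h0 (by linarith), binEntropy_eq_neg]
  have hl : 0 ≤ Real.log (1 - p) - Real.log p :=
    sub_nonneg.2 (Real.log_le_log h0 (by linarith))
  refine Real.exp_le_exp.2 ?_
  nlinarith [mul_le_mul_of_nonneg_right he hl]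

/-- Under Bernoulli noise of rate `r ≥ 1/2` the weight of a vector grows with its Hamming norm, so
each vector counted has probability at least `exp (-n h(r))`, and the total mass is one. -/
theorem card_filter_hammingNorm_ge_le {r : ℝ} (h0 : 1 / 2 ≤ r) (h1 : r < 1) (n : ℕ) :
    ((Finset.univ.filter fun e : Word n => r * n ≤ hammingNorm e).card : ℝ)
      ≤ Real.exp (n * Real.binEntropy r) := by
  have hl : 0 ≤ Real.log r - Real.log (1 - r) :=
    sub_nonneg.2 (Real.log_le_log (by linarith) (by linarith))
  have key : ((Finset.univ.filter fun e : Word n => r * n ≤ hammingNorm e).card : ℝ)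
      * Real.exp (-(n * Real.binEntropy r)) ≤ 1 := by
    rw [← sum_noiseWeight r n, ← nsmul_eq_mul]
    refine le_trans (Finset.card_nsmul_le_sum _ _ _ fun e he => ?_)
      (Finset.sum_le_sum_of_subset_of_nonneg (Finset.filter_subset _ _)
        fun e _ _ => noiseWeight_nonneg (by linarith) h1.le e)
    have he' := (Finset.mem_filter.1 he).2
    rw [noiseWeight_eq_exp (by linarith) h1, binEntropy_eq_neg]
    refine Real.exp_le_exp.2 ?_
    nlinarith [mul_le_mul_of_nonneg_right he' hl]
  rwa [Real.exp_neg, ← div_eq_mul_inv, div_le_one (Real.exp_pos _)] at key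

/-- The volume of the complement of a Hamming ball of relative radius at least one half. -/
theorem card_filter_hammingDist_ge_le {r : ℝ} (h0 : 1 / 2 ≤ r) (h1 : r < 1) {n : ℕ} (d : Word n) :
    ((Finset.univ.filter fun y : Word n => r * n ≤ hammingDist y d).card : ℝ)
      ≤ Real.exp (n * Real.binEntropy r) := by
  refine le_trans ?_ (card_filter_hammingNorm_ge_le h0 h1 n)
  rw [Nat.cast_le]
  refine Finset.card_le_card_of_injOn (fun y => d - y) ?_ sub_right_injective.injOn
  intro y hy
  simpa only [Finset.coe_filter, Finset.mem_univ, true_and, Set.mem_ofPred_eq,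
    hammingDist_eq_hammingNorm, neg_add_eq_sub] using hy

/-! ### Strategies given by finitely many weighted functions -/

/-- The strategy which plays the functions `F ω` with probability `w ω`. -/
noncomputable def Strategy.ofWeights {n : ℕ} {Ω : Type} [Fintype Ω] (w : Ω → ℝ)
    (h0 : ∀ ω, 0 ≤ w ω) (h1 : ∑ ω, w ω = 1) (F : Ω → Fin n → ZMod 2 → ZMod 2) : Strategy n :=
  (PMF.ofFintype (fun ω => ENNReal.ofReal (w ω)) (by
    rw [← ENNReal.ofReal_sum_of_nonneg fun ω _ => h0 ω, h1, ENNReal.ofReal_one])).map F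

theorem Strategy.sum_ofWeights {n : ℕ} {Ω : Type} [Fintype Ω] (w : Ω → ℝ)
    (h0 : ∀ ω, 0 ≤ w ω) (h1 : ∑ ω, w ω = 1) (F : Ω → Fin n → ZMod 2 → ZMod 2)
    (g : (Fin n → ZMod 2 → ZMod 2) → ℝ) :
    ∑ f, (Strategy.ofWeights w h0 h1 F f).toReal * g f = ∑ ω, w ω * g (F ω) := by
  classical
  have h : ∀ f, (Strategy.ofWeights w h0 h1 F f).toReal = ∑ ω, if f = F ω then w ω else 0 := by
    intro f
    rw [Strategy.ofWeights, PMF.map_apply, tsum_fintype, ENNReal.toReal_sum]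
    · refine Finset.sum_congr rfl fun ω _ => ?_
      split_ifs
      · simp [h0 ω]
      · simp
    · intro ω _
      split_ifs <;> simp
  simp_rw [h, Finset.sum_mul]
  rw [Finset.sum_comm]
  refine Finset.sum_congr rfl fun ω _ => ?_
  simp

theorem avgError_ofWeights {n : ℕ} (C : Code n) {Ω : Type} [Fintype Ω] (w : Ω → ℝ)
    (h0 : ∀ ω, 0 ≤ w ω) (h1 : ∑ ω, w ω = 1) (F : Ω → Fin n → ZMod 2 → ZMod 2) :
    avgError C (Strategy.ofWeights w h0 h1 F) = (1 / (C.words.card : ℝ)) * ∑ x : C.words, ∑ ω,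
      w ω * (1 - (C.decoder (x.1 + errorVector (F ω) x.1) x).toReal) := by
  unfold avgError
  congr 1
  exact Finset.sum_congr rfl fun x _ => Strategy.sum_ofWeights w h0 h1 F
    fun f => 1 - (C.decoder (x.1 + errorVector f x.1) x).toReal

theorem probWeightLT_ofWeights {n : ℕ} (C : Code n) {Ω : Type} [Fintype Ω] (w : Ω → ℝ)
    (h0 : ∀ ω, 0 ≤ w ω) (h1 : ∑ ω, w ω = 1) (F : Ω → Fin n → ZMod 2 → ZMod 2) (t : ℝ) :
    probWeightLT C (Strategy.ofWeights w h0 h1 F) t = (1 / (C.words.card : ℝ)) * ∑ x ∈ C.words,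
      ∑ ω, if (hammingNorm (errorVector (F ω) x) : ℝ) / n < t then w ω else 0 := by
  unfold probWeightLT
  congr 1
  refine Finset.sum_congr rfl fun x _ => ?_
  have := Strategy.sum_ofWeights w h0 h1 F
    fun f => if (hammingNorm (errorVector f x) : ℝ) / n < t then (1 : ℝ) else 0
  simpa only [mul_ite, mul_one, mul_zero] using this

theorem Code.card_pos {n : ℕ} (C : Code n) : (0 : ℝ) < C.words.card := by
  exact_mod_cast C.nonempty.card_pos

theorem Code.toReal_decoder_le_one {n : ℕ} (C : Code n) (y : Word n) (x : C.words) :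
    (C.decoder y x).toReal ≤ 1 := by
  simpa using ENNReal.toReal_mono ENNReal.one_ne_top ((C.decoder y).coe_le_one x)

theorem Code.sum_toReal_decoder {n : ℕ} (C : Code n) (y : Word n) :
    ∑ x, (C.decoder y x).toReal = 1 := by
  have h := (C.decoder y).tsum_coe
  rw [tsum_fintype] at h
  rw [← ENNReal.toReal_sum fun x _ => (C.decoder y).apply_ne_top x, h, ENNReal.toReal_one]

theorem probWeightLT_le_one {n : ℕ} (C : Code n) (ν : Strategy n) (t : ℝ) :
    probWeightLT C ν t ≤ 1 := by
  have hν : ∑ f, (ν f).toReal = 1 := by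
    have h := ν.tsum_coe
    rw [tsum_fintype] at h
    rw [← ENNReal.toReal_sum fun f _ => ν.apply_ne_top f, h, ENNReal.toReal_one]
  unfold probWeightLT
  rw [one_div, inv_mul_le_iff₀ C.card_pos]
  calc _ ≤ ∑ x ∈ C.words, (1 : ℝ) := by
        refine Finset.sum_le_sum fun x _ => ?_
        rw [← hν]
        refine Finset.sum_le_sum fun f _ => ?_
        split_ifs
        · exact le_rfl
        · exact ENNReal.toReal_nonneg
    _ = _ := by simp

/-! ### The binary symmetric channel -/

/-- The strategy which adds independent Bernoulli noise. -/
noncomputable def bscStrategy (p : ℝ) (h0 : 0 ≤ p) (h1 : p ≤ 1) (n : ℕ) : Strategy n :=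
  Strategy.ofWeights (fun e : Word n => noiseWeight p e) (noiseWeight_nonneg h0 h1)
    (sum_noiseWeight p n) fun e i _ => e i

theorem sum_ite_not {α : Type*} [Fintype α] (w : α → ℝ) (h1 : ∑ a, w a = 1) (P : α → Prop)
    [DecidablePred P] :
    ∑ a, (if P a then w a else 0) = 1 - ∑ a, (if ¬ P a then w a else 0) := by
  rw [← h1, eq_sub_iff_add_eq, ← Finset.sum_add_distrib]
  exact Finset.sum_congr rfl fun a _ => by split_ifs <;> simp

theorem stronglyLimited_bscStrategy (C : ∀ n, Code n) {p : ℝ} (h0 : 0 ≤ p) (h1 : p ≤ 1) :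
    StronglyLimited C p (bscStrategy p h0 h1) := by
  intro ε hε
  have hlim : Tendsto (fun n : ℕ => 1 - 1 / (ε ^ 2 * n)) atTop (nhds (1 - 0)) := by
    refine tendsto_const_nhds.sub ?_
    have := (tendsto_const_div_atTop_nhds_zero_nat (1 / ε ^ 2))
    simpa only [div_div] using this
  rw [sub_zero] at hlim
  refine tendsto_of_tendsto_of_tendsto_of_le_of_le' hlim tendsto_const_nhds ?_
    (Eventually.of_forall fun n => probWeightLT_le_one _ _ _)
  filter_upwards [eventually_gt_atTop 0] with n hn
  have hn' : (0 : ℝ) < n := by exact_mod_cast hn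
  rw [bscStrategy, probWeightLT_ofWeights, one_div_mul_eq_div, le_div_iff₀ (C n).card_pos,
    mul_comm, ← nsmul_eq_mul]
  refine Finset.card_nsmul_le_sum _ _ _ fun x _ => ?_
  rw [sum_ite_not _ (sum_noiseWeight p n)]
  refine sub_le_sub_left (noiseWeight_hammingNorm_deviation h0 h1 hn hε _ fun e he => ?_) 1
  have he' : p + ε ≤ (hammingNorm e : ℝ) / n := not_lt.1 he
  rw [le_div_iff₀ hn'] at he'
  exact le_trans (by linarith) (le_abs_self _)

/-- Converse for the binary symmetric channel: if the codewords of `A` are sent mostly into the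
set `T`, then few of them are decoded correctly when `T` is small. -/
theorem le_avgError_bscStrategy {n : ℕ} (hn : 0 < n) (C : Code n) {p : ℝ} (h0 : 0 < p)
    (h1 : p ≤ 1 / 2) {γ τ : ℝ} (hγ : 0 < γ) (A : Finset (Word n)) (hA : A ⊆ C.words)
    (T : Finset (Word n))
    (hT : ∀ x ∈ A, ∑ e, (if ¬ x + e ∈ T then noiseWeight p e else 0) ≤ τ) :
    ((1 - 1 / (γ ^ 2 * n) - τ) * A.card
      - Real.exp (-(n * (Real.binEntropy p - γ * (Real.log (1 - p) - Real.log p)))) * T.card)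
        / C.words.card ≤ avgError C (bscStrategy p h0.le (by linarith) n) := by
  set β := Real.exp (-(n * (Real.binEntropy p - γ * (Real.log (1 - p) - Real.log p))))
  have hw : ∀ e : Word n, 0 ≤ noiseWeight p e := noiseWeight_nonneg h0.le (by linarith)
  rw [bscStrategy, avgError_ofWeights, one_div_mul_eq_div]
  refine div_le_div_of_nonneg_right ?_ C.card_pos.le
  have herr : ∀ (x : C.words) (e : Word n), errorVector (fun i _ => e i) x.1 = e := fun _ _ => rfl
  simp_rw [herr]
  have hdec : ∀ x : C.words, ∑ e, (if x.1 + e ∈ T then (C.decoder (x.1 + e) x).toReal else 0)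
      = ∑ y ∈ T, (C.decoder y x).toReal := by
    intro x
    refine (Fintype.sum_equiv (Equiv.addLeft x.1) _
      (fun y => if y ∈ T then (C.decoder y x).toReal else 0) fun e => rfl).trans ?_
    simp
  have hx : ∀ x : C.words, (if x.1 ∈ A then (1 - 1 / (γ ^ 2 * n) - τ) else 0)
      - β * ∑ y ∈ T, (C.decoder y x).toReal
      ≤ ∑ e : Word n, noiseWeight p e * (1 - (C.decoder (x.1 + e) x).toReal) := by
    intro x
    have hS : 0 ≤ β * ∑ y ∈ T, (C.decoder y x).toReal :=
      mul_nonneg (Real.exp_pos _).le (Finset.sum_nonneg fun _ _ => ENNReal.toReal_nonneg)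
    split_ifs with hxA
    · have hatyp := noiseWeight_hammingNorm_deviation h0.le (by linarith : p ≤ 1) hn hγ
        (fun e : Word n => ¬ (p - γ) * n ≤ hammingNorm e) fun e he => by
          rw [abs_sub_comm]
          exact le_trans (by push Not at he; linarith) (le_abs_self _)
      have hout := hT x.1 hxA
      -- Correct decoding needs noise that is too light, or an output outside `T`, or an output in
      -- `T` whose noise has weight at most `β`.
      have hle : ∑ e : Word n, noiseWeight p e * (C.decoder (x.1 + e) x).toReal
          ≤ ∑ e : Word n, ((if ¬ (p - γ) * n ≤ hammingNorm e then noiseWeight p e else 0)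
            + (if ¬ x.1 + e ∈ T then noiseWeight p e else 0)
            + β * (if x.1 + e ∈ T then (C.decoder (x.1 + e) x).toReal else 0)) := by
        refine Finset.sum_le_sum fun e _ => ?_
        have hD0 : 0 ≤ (C.decoder (x.1 + e) x).toReal := ENNReal.toReal_nonneg
        have hle1 := mul_le_of_le_one_right (hw e) (C.toReal_decoder_le_one (x.1 + e) x)
        have hβ : 0 ≤ β * (C.decoder (x.1 + e) x).toReal := mul_nonneg (Real.exp_pos _).le hD0
        have := hw e
        by_cases h : (p - γ) * n ≤ hammingNorm e
        · have := mul_le_mul_of_nonneg_right (noiseWeight_le_exp h0 h1 e h) hD0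
          by_cases h' : x.1 + e ∈ T <;> simp only [h, h', not_true, not_false_iff, if_true,
            if_false, mul_zero] <;> linarith
        · by_cases h' : x.1 + e ∈ T <;> simp only [h, h', not_true, not_false_iff, if_true,
            if_false, mul_zero] <;> linarith
      rw [Finset.sum_add_distrib, Finset.sum_add_distrib, ← Finset.mul_sum, hdec] at hle
      simp_rw [mul_sub, mul_one]
      rw [Finset.sum_sub_distrib, sum_noiseWeight]
      linarith
    · refine le_trans (by linarith) (Finset.sum_nonneg fun e _ => mul_nonneg (hw e) ?_)
      exact sub_nonneg.2 (C.toReal_decoder_le_one _ x)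
  refine le_trans (le_of_eq ?_) (Finset.sum_le_sum fun x _ => hx x)
  rw [Finset.sum_sub_distrib, ← Finset.mul_sum, Finset.sum_comm]
  -- Each word of `T` contributes total decoding probability one, so the last terms add up to `β *
  -- T.card`.
  simp_rw [C.sum_toReal_decoder]
  rw [Finset.sum_coe_sort C.words fun x => if x ∈ A then (1 - 1 / (γ ^ 2 * n) - τ) else 0,
    ← Finset.sum_filter, Finset.filter_mem_eq_inter, Finset.inter_eq_right.2 hA]
  simp only [Finset.sum_const, nsmul_eq_mul, mul_one]
  ring

/-! ### The symmetrizing strategy -/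

/-- The word which agrees with `x` where `b` vanishes and with `x'` elsewhere. -/
def mixWords {n : ℕ} (x x' b : Word n) : Word n := fun i => if b i = 0 then x i else x' i

theorem mixWords_add_one {n : ℕ} (x x' b : Word n) : mixWords x x' (b + 1) = mixWords x' x b := by
  funext i
  have h11 : (1 : ZMod 2) + 1 = 0 := by decide
  rcases zmod_two_cases (b i) with h | h <;> simp [mixWords, h, h11]

/-- The functions which replace the coordinates selected by `b` by those of `x'`. -/
def symFunctions {n : ℕ} (x' b : Word n) : Fin n → ZMod 2 → ZMod 2 :=
  fun i a => if b i = 0 then 0 else a + x' i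

theorem add_errorVector_symFunctions {n : ℕ} (x x' b : Word n) :
    x + errorVector (symFunctions x' b) x = mixWords x x' b := by
  funext i
  simp only [Pi.add_apply, errorVector, symFunctions, mixWords]
  split_ifs
  · exact add_zero _
  · rw [← add_assoc, CharTwo.add_self_eq_zero, zero_add]

/-- The strategy which overwrites a random half of the coordinates by those of a random element
of `G`. -/
noncomputable def symStrategy {n : ℕ} (G : Finset (Word n)) (hG : G.Nonempty) : Strategy n :=
  Strategy.ofWeights (fun ω : G × Word n => 1 / (G.card : ℝ) * noiseWeight (1 / 2) ω.2)
    (fun ω => mul_nonneg (by positivity)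
      (noiseWeight_nonneg (by norm_num) (by norm_num) _))
    (by
      have : (G.card : ℝ) ≠ 0 := by exact_mod_cast hG.card_pos.ne'
      rw [Fintype.sum_prod_type]
      simp_rw [← Finset.mul_sum, sum_noiseWeight]
      simp [this])
    fun ω => symFunctions ω.1.1 ω.2

theorem noiseWeight_half_add_one {n : ℕ} (b : Word n) :
    noiseWeight (1 / 2) (b + 1) = noiseWeight (1 / 2) b := by
  unfold noiseWeight bernWeight
  norm_num

/-- The probability that the decoder outputs `x` on input `y`. -/
noncomputable def Code.decodeProb {n : ℕ} (C : Code n) (y x : Word n) : ℝ :=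
  if h : x ∈ C.words then (C.decoder y ⟨x, h⟩).toReal else 0

theorem Code.decodeProb_le_one {n : ℕ} (C : Code n) (y x : Word n) : C.decodeProb y x ≤ 1 := by
  unfold Code.decodeProb
  split_ifs
  · exact C.toReal_decoder_le_one _ _
  · exact zero_le_one

theorem Code.decodeProb_add_le_one {n : ℕ} (C : Code n) (y : Word n) {x x' : Word n}
    (hne : x ≠ x') : C.decodeProb y x + C.decodeProb y x' ≤ 1 := by
  by_cases hx : x ∈ C.words
  · by_cases hx' : x' ∈ C.words
    · rw [← C.sum_toReal_decoder y, Code.decodeProb, Code.decodeProb, dif_pos hx, dif_pos hx',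
        ← Finset.sum_pair (f := fun z => (C.decoder y z).toReal) (a := ⟨x, hx⟩) (b := ⟨x', hx'⟩)
          (by simpa using hne)]
      exact Finset.sum_le_sum_of_subset_of_nonneg (Finset.subset_univ _)
        fun _ _ _ => ENNReal.toReal_nonneg
    · have : C.decodeProb y x' = 0 := dif_neg hx'
      linarith [C.decodeProb_le_one y x]
  · have : C.decodeProb y x = 0 := dif_neg hx
    linarith [C.decodeProb_le_one y x']

/-- The probability that `x` is not decoded correctly when half of its coordinates are replaced by
those of `x'`. -/
noncomputable def Code.confusion {n : ℕ} (C : Code n) (x x' : Word n) : ℝ :=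
  ∑ b : Word n, noiseWeight (1 / 2) b * (1 - C.decodeProb (mixWords x x' b) x)

theorem Code.confusion_nonneg {n : ℕ} (C : Code n) (x x' : Word n) : 0 ≤ C.confusion x x' :=
  Finset.sum_nonneg fun b _ => mul_nonneg (noiseWeight_nonneg (by norm_num) (by norm_num) b)
    (sub_nonneg.2 (C.decodeProb_le_one _ _))

/-- Complementing the fair mask `b` exchanges the roles of `x` and `x'`, so both errors concern the
same random received word, which cannot be decoded to both. -/
theorem Code.one_le_confusion_add {n : ℕ} (C : Code n) {x x' : Word n} (hne : x ≠ x') :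
    1 ≤ C.confusion x x' + C.confusion x' x := by
  have hsymm : C.confusion x' x
      = ∑ b : Word n, noiseWeight (1 / 2) b * (1 - C.decodeProb (mixWords x x' b) x') := by
    refine Fintype.sum_equiv (Equiv.addRight (1 : Word n)) _ _ fun b => ?_
    rw [Equiv.coe_addRight, noiseWeight_half_add_one, mixWords_add_one]
  rw [hsymm, Code.confusion, ← Finset.sum_add_distrib]
  refine (sum_noiseWeight (1 / 2) n).ge.trans (Finset.sum_le_sum fun b _ => ?_)
  have := C.decodeProb_add_le_one (mixWords x x' b) hne
  have := noiseWeight_nonneg (p := 1 / 2) (by norm_num) (by norm_num) b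
  nlinarith

theorem avgError_symStrategy {n : ℕ} (C : Code n) (G : Finset (Word n)) (hG : G.Nonempty) :
    avgError C (symStrategy G hG) = (1 / (C.words.card : ℝ)) *
      ∑ x ∈ C.words, (1 / (G.card : ℝ)) * ∑ x' ∈ G, C.confusion x x' := by
  rw [symStrategy, avgError_ofWeights, ← Finset.sum_coe_sort C.words]
  congr 1
  refine Finset.sum_congr rfl fun x _ => ?_
  rw [Fintype.sum_prod_type, ← Finset.sum_coe_sort G, Finset.mul_sum]
  refine Finset.sum_congr rfl fun x' _ => ?_
  rw [Code.confusion, Finset.mul_sum]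
  refine Finset.sum_congr rfl fun b _ => ?_
  rw [add_errorVector_symFunctions, mul_assoc, Code.decodeProb, dif_pos x.2]

/-- Averaging over ordered pairs of distinct words of `G` gives error at least one half per pair;
discarding the diagonal costs the `- 1`. -/
theorem le_avgError_symStrategy {n : ℕ} (C : Code n) (G : Finset (Word n)) (hG : G.Nonempty)
    (hGC : G ⊆ C.words) :
    ((G.card : ℝ) - 1) / (2 * C.words.card) ≤ avgError C (symStrategy G hG) := by
  have hg : (0 : ℝ) < G.card := by exact_mod_cast hG.card_pos
  have hpair : (G.card : ℝ) * (G.card - 1) ≤ 2 * ∑ x ∈ G, ∑ x' ∈ G, C.confusion x x' := by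
    have h2 : 2 * ∑ x ∈ G, ∑ x' ∈ G, C.confusion x x'
        = ∑ x ∈ G, ∑ x' ∈ G, (C.confusion x x' + C.confusion x' x) := by
      simp_rw [Finset.sum_add_distrib]
      rw [Finset.sum_comm (f := fun x x' => C.confusion x' x), two_mul]
    rw [h2, ← nsmul_eq_mul]
    refine Finset.card_nsmul_le_sum _ _ _ fun x hx => ?_
    rw [← Finset.add_sum_erase G _ hx]
    have hle : ((G.erase x).card : ℝ) ≤ ∑ x' ∈ G.erase x, (C.confusion x x' + C.confusion x' x) := by
      rw [← mul_one ((G.erase x).card : ℝ), ← nsmul_eq_mul]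
      exact Finset.card_nsmul_le_sum _ _ _ fun x' hx' =>
        C.one_le_confusion_add (Finset.ne_of_mem_erase hx').symm
    rw [Finset.cast_card_erase_of_mem hx] at hle
    linarith [C.confusion_nonneg x x]
  rw [avgError_symStrategy, ← Finset.mul_sum, one_div_mul_eq_div, one_div_mul_eq_div, div_div,
    div_le_div_iff₀ (by linarith [C.card_pos]) (mul_pos hg C.card_pos)]
  have hsub : ∑ x ∈ G, ∑ x' ∈ G, C.confusion x x'
      ≤ ∑ x ∈ C.words, ∑ x' ∈ G, C.confusion x x' :=
    Finset.sum_le_sum_of_subset_of_nonneg hGC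
      fun x _ _ => Finset.sum_nonneg fun x' _ => C.confusion_nonneg x x'
  nlinarith [mul_le_mul_of_nonneg_right (hpair.trans (mul_le_mul_of_nonneg_left hsub two_pos.le))
    C.card_pos.le]

theorem hammingNorm_errorVector_symFunctions_deviation {n : ℕ} (hn : 0 < n) (x x' : Word n)
    {p ε : ℝ} (hε : 0 < ε) (hd : (hammingDist x x' : ℝ) ≤ 2 * p * n) :
    ∑ b : Word n, (if ¬ (hammingNorm (errorVector (symFunctions x' b) x) : ℝ) / n < p + ε
      then noiseWeight (1 / 2) b else 0) ≤ 1 / (ε ^ 2 * n) := by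
  have hn' : (0 : ℝ) < n := by exact_mod_cast hn
  refine chebyshev_noiseWeight (by norm_num) (by norm_num)
    -- Each coordinate where `x` and `x'` differ is hit with probability 1/2, so the mean weight is
    -- half their distance, at most `p * n`.
    (fun i a => (if (if a = 0 then 0 else x i + x' i) ≠ 0 then 1 else 0)
      - (1 / 2) * (if x i ≠ x' i then 1 else 0)) ?_ ?_ hε hn _ ?_
  · intro i
    rw [sum_zmod_two]
    have : x i + x' i = 0 ↔ x i = x' i := CharTwo.add_eq_zero
    by_cases h : x i = x' i
    · simp [bernWeight, h, CharTwo.add_self_eq_zero]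
    · simp [bernWeight, h, this]; norm_num
  · intro i a; rw [abs_le]; split_ifs <;> constructor <;> norm_num
  · intro b hb
    rw [not_lt, le_div_iff₀ hn'] at hb
    rw [Finset.sum_sub_distrib, ← Finset.mul_sum]
    refine le_trans ?_ (le_abs_self _)
    calc ε * n ≤ hammingNorm (errorVector (symFunctions x' b) x) - 1 / 2 * hammingDist x x' := by
          linarith
      _ = _ := by
          rw [hammingNorm_eq_sum, hammingDist_eq_sum]
          congr!

/-- The codewords at relative distance more than `2p` from `d`. -/
noncomputable def farWords {n : ℕ} (C : Code n) (p : ℝ) (d : Word n) : Finset (Word n) :=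
  C.words.filter fun x => 2 * p * n < hammingDist x d

/-- The codewords which are far from at most a fraction `δ` of the code. -/
noncomputable def centralWords {n : ℕ} (C : Code n) (p δ : ℝ) : Finset (Word n) :=
  C.words.filter fun d => ((farWords C p d).card : ℝ) ≤ δ * C.words.card

/-- For each central `x'`, at most a fraction `δ` of the sent words is farther than `2pn`; for the
others Chebyshev's inequality bounds the failure probability. -/
theorem le_probWeightLT_symStrategy {n : ℕ} (hn : 0 < n) (C : Code n) {p δ ε : ℝ} (hε : 0 < ε)
    (hG : (centralWords C p δ).Nonempty) :
    1 - δ - 1 / (ε ^ 2 * n) ≤ probWeightLT C (symStrategy (centralWords C p δ) hG) (p + ε) := by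
  set G := centralWords C p δ with hGdef
  set τ := 1 / (ε ^ 2 * n) with hτ
  have hτ0 : 0 ≤ τ := by positivity
  have hg : (0 : ℝ) < G.card := by exact_mod_cast hG.card_pos
  rw [symStrategy, probWeightLT_ofWeights, one_div_mul_eq_div, le_div_iff₀ C.card_pos]
  have hpt : ∀ x x' : Word n, 1 - τ - (if 2 * p * n < hammingDist x x' then 1 else 0)
      ≤ ∑ b : Word n, if (hammingNorm (errorVector (symFunctions x' b) x) : ℝ) / n < p + ε
        then noiseWeight (1 / 2) b else 0 := by
    intro x x'
    split_ifs with h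
    · refine le_trans (by linarith) (Finset.sum_nonneg fun b _ => ?_)
      split_ifs
      · exact noiseWeight_nonneg (by norm_num) (by norm_num) b
      · exact le_rfl
    · rw [sum_ite_not _ (sum_noiseWeight (1 / 2) n), sub_zero]
      exact sub_le_sub_left
        (hammingNorm_errorVector_symFunctions_deviation hn x x' hε (not_lt.1 h)) 1
  have hrow : ∀ x' ∈ G, (1 - δ - τ) * C.words.card
      ≤ ∑ x ∈ C.words, (1 - τ - (if 2 * p * n < hammingDist x x' then (1 : ℝ) else 0)) := by
    intro x' hx'
    have hx'' := (Finset.mem_filter.1 hx').2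
    rw [Finset.sum_sub_distrib, Finset.sum_boole, Finset.sum_const, nsmul_eq_mul]
    change _ ≤ _ - ((farWords C p x').card : ℝ)
    linarith
  calc (1 - δ - τ) * C.words.card
      = 1 / (G.card : ℝ) * ∑ x' ∈ G, (1 - δ - τ) * C.words.card := by
        rw [Finset.sum_const, nsmul_eq_mul]; field_simp
    _ ≤ 1 / (G.card : ℝ) * ∑ x' ∈ G, ∑ x ∈ C.words,
          ∑ b : Word n, if (hammingNorm (errorVector (symFunctions x' b) x) : ℝ) / n < p + ε
            then noiseWeight (1 / 2) b else 0 := by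
        refine mul_le_mul_of_nonneg_left (Finset.sum_le_sum fun x' hx' => ?_) (by positivity)
        exact (hrow x' hx').trans (Finset.sum_le_sum fun x _ => hpt x x')
    _ = _ := by
        rw [Finset.sum_comm, Finset.mul_sum]
        refine Finset.sum_congr rfl fun x _ => ?_
        rw [Fintype.sum_prod_type, ← Finset.sum_coe_sort G, Finset.mul_sum]
        refine Finset.sum_congr rfl fun x' _ => ?_
        rw [Finset.mul_sum]
        exact Finset.sum_congr rfl fun b _ => by rw [mul_ite, mul_zero]

/-! ### Covering by few neighbourhoods -/

/-- If every vertex of `U` has at least a fraction `δ` of `V` as neighbours, then `K` well chosen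
neighbourhoods cover all but a fraction `(1 - δ) ^ K` of `U`. -/
theorem exists_card_le_uncovered_le {α : Type*} [DecidableEq α] (V U : Finset α)
    (hV : V.Nonempty) (R : α → α → Prop) [DecidableRel R] {δ : ℝ} (h1 : δ ≤ 1)
    (h : ∀ x ∈ U, δ * V.card ≤ (V.filter fun d => R d x).card) (K : ℕ) :
    ∃ D A : Finset α, D.card ≤ K ∧ A ⊆ U ∧ (∀ x ∈ A, ∃ d ∈ D, R d x) ∧
      ((U \ A).card : ℝ) ≤ (1 - δ) ^ K * U.card := by
  induction K with
  | zero => exact ⟨∅, ∅, by simp⟩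
  | succ K ih =>
    obtain ⟨D, A, hD, hAU, hAD, hU⟩ := ih
    set U' := U \ A with hU'
    -- Double counting: some `d` is adjacent to at least the average fraction `δ` of the uncovered
    -- vertices, so each round multiplies their number by at most `1 - δ`.
    obtain ⟨d, -, hd⟩ : ∃ d ∈ V, δ * U'.card ≤ ((U'.filter fun x => R d x).card : ℝ) := by
      refine Finset.exists_le_of_sum_le hV ?_
      have hswap : ∑ d ∈ V, ((U'.filter fun x => R d x).card : ℝ)
          = ∑ x ∈ U', ((V.filter fun d => R d x).card : ℝ) := by
        exact_mod_cast Finset.sum_card_bipartiteAbove_eq_sum_card_bipartiteBelow R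
      rw [hswap]
      calc ∑ d ∈ V, δ * (U'.card : ℝ) = ∑ x ∈ U', δ * (V.card : ℝ) := by
            simp only [Finset.sum_const, nsmul_eq_mul]; ring
        _ ≤ _ := Finset.sum_le_sum fun x hx => h x (Finset.sdiff_subset hx)
    refine ⟨insert d D, A ∪ U'.filter fun x => R d x,
      (Finset.card_insert_le _ _).trans (by omega),
      Finset.union_subset hAU ((Finset.filter_subset _ _).trans Finset.sdiff_subset), ?_, ?_⟩
    · intro x hx
      rcases Finset.mem_union.1 hx with hx | hx
      · obtain ⟨c, hc, hcx⟩ := hAD x hx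
        exact ⟨c, Finset.mem_insert_of_mem hc, hcx⟩
      · exact ⟨d, Finset.mem_insert_self _ _, (Finset.mem_filter.1 hx).2⟩
    · have hsdiff : U \ (A ∪ U'.filter fun x => R d x) = U'.filter fun x => ¬ R d x := by
        rw [Finset.filter_not, hU', Finset.sdiff_sdiff_left']
        ext x
        simp only [Finset.mem_sdiff, Finset.mem_union, Finset.mem_inter]
        tauto
      have hsplit : ((U'.filter fun x => R d x).card : ℝ) + (U'.filter fun x => ¬ R d x).card
          = U'.card := by
        exact_mod_cast Finset.card_filter_add_card_filter_not (s := U') (fun x => R d x)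
      rw [hsdiff, pow_succ]
      nlinarith [mul_le_mul_of_nonneg_left hU (by linarith : 0 ≤ 1 - δ)]

/-! ### The capacity bounds -/

/-- The value `ε = 1/16` lies below the error that both attacks force. A limsup above `B` only makes
the code large for infinitely many lengths, hence `∃ᶠ`; the factor `Real.log 2` passes to natural
logarithms. -/
theorem strongCapacity_le_of_isGood {p B : ℝ}
    (h : ∀ C : ∀ n, Code n, IsGood p (1 / 16) C → ∀ η : ℝ, 0 < η →
      ¬ ∃ᶠ n : ℕ in atTop, Real.exp (n * (B * Real.log 2 + η)) ≤ (C n).words.card) :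
    strongCapacity p ≤ (B : EReal) := by
  refine iInf₂_le_of_le (1 / 16) (by norm_num) (iSup₂_le fun C hC => ?_)
  by_contra! hlt
  obtain ⟨r, hBr, hr⟩ := EReal.lt_iff_exists_real_btwn.1 hlt
  have hl2 := Real.log_pos one_lt_two
  have hBr' : B < r := by exact_mod_cast hBr
  refine h C hC ((r - B) * Real.log 2) (mul_pos (by linarith) hl2) ?_
  refine ((frequently_lt_of_lt_limsup (by isBoundedDefault) hr).and_eventually
    (eventually_gt_atTop 0)).mono ?_
  rintro n ⟨hn, hn0⟩
  have hn' : (0 : ℝ) < n := by exact_mod_cast hn0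
  have hrate : r < rate (C n) := by exact_mod_cast hn
  rw [rate, lt_div_iff₀ hn', Real.logb, lt_div_iff₀ hl2] at hrate
  rw [← Real.le_log_iff_exp_le (C n).card_pos]
  nlinarith

theorem Code.card_le_two_pow {n : ℕ} (C : Code n) : C.words.card ≤ 2 ^ n := by
  simpa using Finset.card_le_univ C.words

theorem strongCapacity_zero_le : strongCapacity 0 ≤ ((1 : ℝ) : EReal) := by
  refine strongCapacity_le_of_isGood fun C _ η hη hfreq => ?_
  obtain ⟨n, hn, hn0⟩ := (hfreq.and_eventually (eventually_gt_atTop 0)).exists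
  have hn' : (0 : ℝ) < n := by exact_mod_cast hn0
  have hle : ((C n).words.card : ℝ) ≤ Real.exp (n * Real.log 2) := by
    rw [Real.exp_nat_mul, Real.exp_log two_pos]
    exact_mod_cast (C n).card_le_two_pow
  have := Real.exp_le_exp.1 (hn.trans hle)
  nlinarith

/-- A code with more than `exp (n (H - h(p)))` words, a quarter of which are sent by the binary
symmetric channel into a set of about `exp (n H)` words, has a large error probability. -/
theorem eventually_lt_avgError_bscStrategy {p : ℝ} (h0 : 0 < p) (h1 : p ≤ 1 / 2) {γ η : ℝ}
    (hγ : 0 < γ) (hη : γ * (Real.log (1 - p) - Real.log p) < η) (H K : ℝ) :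
    ∀ᶠ n : ℕ in atTop, ∀ (C : Code n) (A T : Finset (Word n)), A ⊆ C.words →
      (C.words.card : ℝ) ≤ 4 * A.card →
      (∀ x ∈ A, ∑ e, (if ¬ x + e ∈ T then noiseWeight p e else 0) ≤ 1 / (γ ^ 2 * n)) →
      (T.card : ℝ) ≤ K * Real.exp (n * H) →
      Real.exp (n * (H - Real.binEntropy p + η)) ≤ C.words.card →
      1 / 16 < avgError C (bscStrategy p h0.le (by linarith) n) := by
  have hτ : ∀ᶠ n : ℕ in atTop, 1 / (γ ^ 2 * n) < 1 / 8 := by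
    have := (tendsto_const_div_atTop_nhds_zero_nat (1 / γ ^ 2)).eventually
      (gt_mem_nhds (by norm_num : (0 : ℝ) < 1 / 8))
    simpa only [div_div] using this
  set L := Real.log (1 - p) - Real.log p
  have hK : ∀ᶠ n : ℕ in atTop, K * Real.exp (-(n * (η - γ * L))) < 1 / 16 := by
    have h2 : Tendsto (fun n : ℕ => (n : ℝ) * (η - γ * L)) atTop atTop :=
      tendsto_natCast_atTop_atTop.atTop_mul_const (by linarith)
    have := (Real.tendsto_exp_neg_atTop_nhds_zero.comp h2).const_mul K
    rw [mul_zero] at this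
    exact this.eventually (gt_mem_nhds (by norm_num : (0 : ℝ) < 1 / 16))
  filter_upwards [hτ, hK, eventually_gt_atTop 0] with n hτn hKn hn C A T hAC hA hT hTK hC
  refine lt_of_lt_of_le ?_ (le_avgError_bscStrategy hn C h0 h1 hγ A hAC T hT)
  rw [lt_div_iff₀ C.card_pos]
  have hbad : Real.exp (-(n * (Real.binEntropy p - γ * L))) * T.card
      ≤ 1 / 16 * C.words.card := by
    calc Real.exp (-(n * (Real.binEntropy p - γ * L))) * T.card
        ≤ Real.exp (-(n * (Real.binEntropy p - γ * L))) * (K * Real.exp (n * H)) :=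
          mul_le_mul_of_nonneg_left hTK (Real.exp_pos _).le
      _ = K * Real.exp (-(n * (η - γ * L))) * Real.exp (n * (H - Real.binEntropy p + η)) := by
          rw [mul_left_comm, ← Real.exp_add, mul_assoc, ← Real.exp_add]
          ring_nf
      _ ≤ 1 / 16 * Real.exp (n * (H - Real.binEntropy p + η)) :=
          mul_le_mul_of_nonneg_right hKn.le (Real.exp_pos _).le
      _ ≤ 1 / 16 * C.words.card := mul_le_mul_of_nonneg_left hC (by norm_num)
  have hA0 : (0 : ℝ) ≤ A.card := Nat.cast_nonneg _
  nlinarith [C.card_pos, mul_le_mul_of_nonneg_right hτn.le hA0]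

theorem strongCapacity_le_one_sub {p : ℝ} (h0 : 0 < p) (h1 : p ≤ 1 / 2) :
    strongCapacity p ≤ ((1 - hB p : ℝ) : EReal) := by
  refine strongCapacity_le_of_isGood fun C hC η hη hfreq => ?_
  have hl2 := Real.log_pos one_lt_two
  set L := Real.log (1 - p) - Real.log p with hL
  have hL0 : 0 ≤ L := sub_nonneg.2 (Real.log_le_log h0 (by linarith))
  have hγ : 0 < η / (L + 1) := by positivity
  have hγη : η / (L + 1) * L < η := by
    rw [div_mul_eq_mul_div, div_lt_iff₀ (by linarith)]; nlinarith
  have hgood := hC _ (stronglyLimited_bscStrategy C h0.le (by linarith : p ≤ 1))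
  obtain ⟨n, ⟨hn, hbad⟩, hle⟩ := ((hfreq.and_eventually
    (eventually_lt_avgError_bscStrategy h0 h1 hγ hγη (Real.log 2) 1)).and_eventually hgood).exists
  refine absurd hle (not_le.2 (hbad (C n) (C n).words Finset.univ subset_rfl ?_ ?_ ?_ ?_))
  · linarith [(C n).card_pos]
  · intro x _
    simp only [Finset.mem_univ, not_true, if_false, Finset.sum_const_zero]
    positivity
  · rw [Real.exp_nat_mul, Real.exp_log two_pos]
    simp
  · convert hn using 3
    rw [hB]
    field_simp

/-- Either many codewords are central, or few neighbourhoods of far words contain a quarter of the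
code. -/
theorem exists_card_le_far_cover {n : ℕ} (C : Code n) (p : ℝ) {δ : ℝ} (h1 : δ ≤ 1)
    (hcentral : 2 * (centralWords C p δ).card < C.words.card) {K : ℕ}
    (hK : (1 - δ) ^ K ≤ 1 / 2) :
    ∃ D A : Finset (Word n), D.card ≤ K ∧ A ⊆ C.words ∧ (C.words.card : ℝ) ≤ 4 * A.card ∧
      ∀ x ∈ A, ∃ d ∈ D, 2 * p * n < hammingDist x d := by
  set U := C.words.filter fun d => ¬ ((farWords C p d).card : ℝ) ≤ δ * C.words.card with hU
  have hcard : ((centralWords C p δ).card : ℝ) + U.card = C.words.card := by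
    exact_mod_cast Finset.card_filter_add_card_filter_not (s := C.words)
      (fun d => ((farWords C p d).card : ℝ) ≤ δ * C.words.card)
  obtain ⟨D, A, hD, hAU, hAD, hunc⟩ := exists_card_le_uncovered_le C.words U C.nonempty
    (fun d x => 2 * p * n < hammingDist d x) h1
    (fun x hx => (not_le.1 (Finset.mem_filter.1 hx).2).le) K
  refine ⟨D, A, hD, hAU.trans (Finset.filter_subset _ _), ?_, fun x hx => ?_⟩
  -- More than half of the code is in `U` and at least half of `U` is covered, hence the quarter.
  · rw [Finset.cast_card_sdiff hAU] at hunc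
    have hc : (2 * (centralWords C p δ).card : ℝ) < C.words.card := by exact_mod_cast hcentral
    have := mul_le_mul_of_nonneg_right hK (Nat.cast_nonneg (α := ℝ) U.card)
    linarith
  · obtain ⟨d, hd, hdx⟩ := hAD x hx
    exact ⟨d, hd, by rwa [hammingDist_comm]⟩

/-- A code family many of whose words are central for arbitrarily small fractions `δ` is defeated
by a symmetrizing strategy. -/
theorem not_isGood_of_frequently_central {C : ∀ n, Code n} {p : ℝ} (hp : 0 ≤ p)
    (h : ∀ k : ℕ, ∃ᶠ n in atTop, 4 ≤ (C n).words.card ∧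
      (C n).words.card ≤ 2 * (centralWords (C n) p (1 / (k + 2))).card) :
    ¬ IsGood p (1 / 16) C := by
  intro hC
  -- Diagonal choice: length `φ k` uses `δ = 1 / (k + 2)`, so `δ` tends to zero along `φ`, as strong
  -- limitation requires. At other lengths the adversary adds no noise.
  obtain ⟨φ, hφ, hφC⟩ := extraction_forall_of_frequently h
  have hne : ∀ k : ℕ, (centralWords (C (φ k)) p (1 / (k + 2))).Nonempty := fun k =>
    Finset.card_pos.1 (by have := hφC k; omega)
  classical
  let ν : ∀ n, Strategy n := fun n =>
    if hn : ∃ k, φ k = n then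
      symStrategy (centralWords (C n) p (1 / ((hn.choose : ℕ) + 2)))
        (by have := hne hn.choose; rwa [hn.choose_spec] at this)
    else bscStrategy 0 le_rfl zero_le_one n
  have hν : ∀ k, ν (φ k) = symStrategy _ (hne k) := by
    intro k
    have hk : ∃ j, φ j = φ k := ⟨k, rfl⟩
    have hj : hk.choose = k := hφ.injective hk.choose_spec
    simp only [ν, dif_pos hk, hj]
  have hlim : StronglyLimited C p ν := by
    intro ε hε
    rw [tendsto_order]
    refine ⟨fun t ht => ?_, fun t ht => Eventually.of_forall fun n =>
      (probWeightLT_le_one _ _ _).trans_lt ht⟩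
    have hzero := (tendsto_order.1 (stronglyLimited_bscStrategy C le_rfl zero_le_one _
      (by linarith : 0 < p + ε))).1 t ht
    have hτ : ∀ᶠ n : ℕ in atTop, 1 / (ε ^ 2 * n) < (1 - t) / 2 := by
      have := (tendsto_const_div_atTop_nhds_zero_nat (1 / ε ^ 2)).eventually
        (gt_mem_nhds (by linarith : 0 < (1 - t) / 2))
      simpa only [div_div] using this
    obtain ⟨k₀, hk₀⟩ := exists_nat_one_div_lt (by linarith : 0 < (1 - t) / 2)
    filter_upwards [hzero, hτ, eventually_ge_atTop (φ k₀), eventually_gt_atTop 0]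
      with n hzn hτn hn hn0
    by_cases hex : ∃ k, φ k = n
    · obtain ⟨k, rfl⟩ := hex
      rw [hν]
      refine lt_of_lt_of_le ?_ (le_probWeightLT_symStrategy hn0 (C (φ k)) hε (hne k))
      have hkk : (k₀ : ℝ) ≤ k := by exact_mod_cast hφ.le_iff_le.1 hn
      have : (1 : ℝ) / (k + 2) ≤ 1 / (k₀ + 1) :=
        one_div_le_one_div_of_le (by positivity) (by linarith)
      linarith
    · rw [zero_add] at hzn
      simpa only [ν, dif_neg hex] using hzn
  have hbad := hC ν hlim
  obtain ⟨k, hk⟩ := (hφ.tendsto_atTop.eventually hbad).exists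
  have hc := hφC k
  have hle := le_avgError_symStrategy (C (φ k)) _ (hne k) (Finset.filter_subset _ _)
  rw [hν] at hk
  have h4 : (4 : ℝ) ≤ (C (φ k)).words.card := by exact_mod_cast hc.1
  have h2 : ((C (φ k)).words.card : ℝ) ≤ 2 * (centralWords (C (φ k)) p (1 / (k + 2))).card := by
    exact_mod_cast hc.2
  have := hle.trans hk
  -- With `4 ≤ |C| ≤ 2|G|`, the quotient `(|G| - 1) / (2|C|)` is at least 1/8.
  rw [div_le_iff₀ (by linarith)] at this
  linarith

theorem strongCapacity_le_sub {p : ℝ} (h0 : 1 / 4 < p) (h1 : p < 1 / 2) :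
    strongCapacity p ≤ ((hB (1 - 3 * p + 4 * p ^ 2) - hB p : ℝ) : EReal) := by
  refine strongCapacity_le_of_isGood fun C hC η hη hfreq => ?_
  have hl2 := Real.log_pos one_lt_two
  set r₀ := 3 * p - 4 * p ^ 2 with hr₀
  -- Here `2r₀ - 1 = (4p - 1)(1 - 2p)`, which is where `p > 1/4` enters; next, `1 - p - r₀ = (1 -
  -- 2p)²`.
  have hr₀half : 1 / 2 < r₀ := by nlinarith
  have hr₀one : r₀ ≤ 1 - p := by nlinarith
  have hB' : (hB (1 - 3 * p + 4 * p ^ 2) - hB p) * Real.log 2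
      = Real.binEntropy r₀ - Real.binEntropy p := by
    rw [← Real.binEntropy_one_sub r₀, hr₀, hB, hB, sub_mul, div_mul_cancel₀ _ hl2.ne',
      div_mul_cancel₀ _ hl2.ne']
    ring_nf
  rw [hB'] at hfreq
  have hent : Real.binEntropy p ≤ Real.binEntropy r₀ := by
    rw [← Real.binEntropy_one_sub r₀]
    exact Real.binEntropy_strictMonoOn.monotoneOn ⟨by linarith, by norm_num; linarith⟩
      ⟨by linarith, by norm_num; linarith⟩ (by linarith)
  have hfour : ∀ᶠ n : ℕ in atTop, (4 : ℝ) ≤ Real.exp (n * η) :=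
    (Real.tendsto_exp_atTop.comp
      (tendsto_natCast_atTop_atTop.atTop_mul_const hη)).eventually_ge_atTop 4
  -- Either central words are plentiful infinitely often for every `δ = 1 / (k + 2)`, or one fixed
  -- `δ` fails at all large lengths where the code is large; then `K` is independent of the length.
  by_cases hcen : ∀ k : ℕ, ∃ᶠ n : ℕ in atTop,
      Real.exp (n * (Real.binEntropy r₀ - Real.binEntropy p + η)) ≤ (C n).words.card ∧
      (C n).words.card ≤ 2 * (centralWords (C n) p (1 / (k + 2))).card
  · refine not_isGood_of_frequently_central (by linarith) (fun k => ?_) hC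
    refine ((hcen k).and_eventually hfour).mono ?_
    rintro n ⟨⟨hn, hn'⟩, h4⟩
    refine ⟨?_, hn'⟩
    have : Real.exp (n * η) ≤ Real.exp (n * (Real.binEntropy r₀ - Real.binEntropy p + η)) :=
      Real.exp_le_exp.2 (mul_le_mul_of_nonneg_left (by linarith) (Nat.cast_nonneg n))
    exact_mod_cast h4.trans (this.trans hn)
  push Not at hcen
  obtain ⟨k, hk⟩ := hcen
  set δ : ℝ := 1 / (k + 2) with hδ
  have hδ0 : 0 < δ := by positivity
  have hδ1 : δ ≤ 1 := by rw [hδ, div_le_one (by positivity)]; linarith [Nat.cast_nonneg (α := ℝ) k]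
  obtain ⟨K, hK⟩ := exists_pow_lt_of_lt_one (by norm_num : (0 : ℝ) < 1 / 2)
    (by linarith : 1 - δ < 1)
  set L := Real.log (1 - p) - Real.log p with hL
  obtain ⟨γ, hγent, hγhalf, hγ⟩ : ∃ γ : ℝ, Real.binEntropy (r₀ - γ) + γ * L
      < Real.binEntropy r₀ + η ∧ 1 / 2 < r₀ - γ ∧ 0 < γ := by
    have hc : Tendsto (fun γ : ℝ => Real.binEntropy (r₀ - γ) + γ * L) (nhds 0)
        (nhds (Real.binEntropy (r₀ - 0) + 0 * L)) := by
      have : Continuous fun γ : ℝ => Real.binEntropy (r₀ - γ) + γ * L := by fun_prop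
      exact this.tendsto 0
    have hc' : Tendsto (fun γ : ℝ => r₀ - γ) (nhds 0) (nhds (r₀ - 0)) :=
      (continuous_const.sub continuous_id).tendsto 0
    have e1 := hc.eventually (gt_mem_nhds (show _ < Real.binEntropy r₀ + η by simpa using hη))
    have e2 := hc'.eventually (lt_mem_nhds (show 1 / 2 < r₀ - 0 by simpa using hr₀half))
    obtain ⟨γ, ⟨hγ1, hγ2⟩, hγ3⟩ := (((e1.and e2).filter_mono nhdsWithin_le_nhds).and
      (self_mem_nhdsWithin (a := (0 : ℝ)) (s := Set.Ioi 0))).exists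
    exact ⟨γ, hγ1, hγ2, hγ3⟩
  have hgood := hC _ (stronglyLimited_bscStrategy C (by linarith : 0 ≤ p) (by linarith : p ≤ 1))
  -- The `η` supplied absorbs the change of entropy from `r₀` to `r₀ - γ`, so the size threshold
  -- stays that of `hfreq`.
  obtain ⟨n, ⟨⟨⟨hn, hcard⟩, hbad⟩, hle⟩, hn0⟩ := ((((hfreq.and_eventually hk).and_eventually
    (eventually_lt_avgError_bscStrategy (by linarith : 0 < p) h1.le hγ
      (η := Real.binEntropy r₀ + η - Real.binEntropy (r₀ - γ)) (by linarith)
      (Real.binEntropy (r₀ - γ)) K)).and_eventually hgood).and_eventually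
      (eventually_gt_atTop 0)).exists
  obtain ⟨D, A, hD, hAC, hA, hfar⟩ := exists_card_le_far_cover (C n) p hδ1 (hcard hn) hK.le
  let T : Finset (Word n) :=
    D.biUnion fun d => Finset.univ.filter fun y => (r₀ - γ) * n ≤ hammingDist y d
  refine absurd hle (not_le.2 (hbad (C n) A T hAC hA ?_ ?_ ?_))
  · intro x hx
    obtain ⟨d, hd, hxd⟩ := hfar x hx
    refine le_trans (Finset.sum_le_sum fun e _ => ?_)
      (noiseWeight_hammingDist_deviation (by linarith) h1.le hn0 hγ x d hxd.le
        (r := r₀ - γ) (by rw [hr₀]; linarith))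
    have hmem : (r₀ - γ) * n ≤ hammingDist (x + e) d → x + e ∈ T := fun h =>
      Finset.mem_biUnion.2 ⟨d, hd, Finset.mem_filter.2 ⟨Finset.mem_univ _, h⟩⟩
    have hw := noiseWeight_nonneg (by linarith : 0 ≤ p) (by linarith) e
    by_cases h : (r₀ - γ) * n ≤ hammingDist (x + e) d
    · simp [h, hmem h]
    · simp only [h, not_false_iff, if_true]
      split_ifs
      · exact hw
      · exact le_rfl
  · calc (T.card : ℝ)
        ≤ ∑ d ∈ D, ((Finset.univ.filter
            fun y : Word n => (r₀ - γ) * n ≤ hammingDist y d).card : ℝ) := by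
          exact_mod_cast Finset.card_biUnion_le
      _ ≤ ∑ d ∈ D, Real.exp (n * Real.binEntropy (r₀ - γ)) :=
          Finset.sum_le_sum fun d _ => card_filter_hammingDist_ge_le hγhalf.le (by linarith) d
      _ ≤ K * Real.exp (n * Real.binEntropy (r₀ - γ)) := by
          rw [Finset.sum_const, nsmul_eq_mul]
          exact mul_le_mul_of_nonneg_right (by exact_mod_cast hD) (Real.exp_pos _).le
  · convert hn using 3
    ring

theorem theorem2 (p : ℝ) :
    (0 ≤ p → p ≤ 1 / 4 → strongCapacity p ≤ ((1 - hB p : ℝ) : EReal)) ∧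
    (1 / 4 < p → p ≤ 1 / 2 →
      strongCapacity p ≤ ((hB (1 - 3 * p + 4 * p ^ 2) - hB p : ℝ) : EReal)) ∧
    (1 / 4 < p → p < 1 / 2 → hB (1 - 3 * p + 4 * p ^ 2) - hB p < 1 - hB p) := by
  have hl2 := Real.log_pos one_lt_two
  refine ⟨fun h0 h1 => ?_, fun h0 h1 => ?_, fun h0 h1 => ?_⟩
  · rcases h0.eq_or_lt with rfl | h0
    · simpa [hB] using strongCapacity_zero_le
    · exact strongCapacity_le_one_sub h0 (by linarith)
  · rcases h1.eq_or_lt with rfl | h1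
    · have hone : hB (1 - 3 * (1 / 2) + 4 * (1 / 2) ^ 2) = 1 := by
        rw [show (1 - 3 * (1 / 2) + 4 * (1 / 2) ^ 2 : ℝ) = 2⁻¹ by norm_num, hB,
          Real.binEntropy_two_inv, div_self hl2.ne']
      rw [hone]
      exact strongCapacity_le_one_sub (by norm_num) le_rfl
    · exact strongCapacity_le_sub h0 h1
  · refine sub_lt_sub_right ?_ _
    -- Equality would need `1 - 3p + 4p² = 1/2`, that is `(4p - 1)(1 - 2p) = 0`.
    rw [hB, div_lt_one hl2, Real.binEntropy_lt_log_two]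
    norm_num
    nlinarith
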